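/- Let $n\ge 0$, let $A\in M_{n\times n}(\mathbb{C})$, $\alpha>0$, $p>1$ and $q=\frac{p}{p-1}$. For a matrix $X\in M_{n\times n}(\mathbb{C})$ write $|X|=(X^{*}X)^{1/2}$. Let $|||\cdot|||$ be any unitarily invariant norm on $M_{n\times n}(\mathbb{C})$, that is, a norm with $|||UXV|||=|||X|||$ for all $X$ and all unitary $U,V$. Then $$|||\,|A|^{\alpha}\,||| \;=\; \min_{A=BC}\Big\{\,|||\,|B|^{\alpha p}\,|||^{1/p}\;|||\,|C|^{\alpha q}\,|||^{1/q}\Big\}\;=\;\min_{A=BC}\Big\{\tfrac1p\,|||\,|B|^{\alpha p}\,|||+\tfrac1q\,|||\,|C|^{\alpha q}\,|||\Big\},$$ where both minima are taken over all pairs $B,C\in M_{n\times n}(\mathbb{C})$ with $A=BC$, and both are attained. -/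

import Mathlib

open scoped MatrixOrder

/-- `N` is a unitarily invariant norm on the complex `n × n` matrices: a seminorm (nonnegative,
subadditive, absolutely homogeneous over `ℂ`) that vanishes only at `0` and satisfies
`N (U * X * V) = N X` for all unitary `U`, `V`. -/
structure IsUnitarilyInvariantNorm {n : ℕ} (N : Seminorm ℂ (Matrix (Fin n) (Fin n) ℂ)) : Prop where
  eq_zero_of_map_eq_zero : ∀ X : Matrix (Fin n) (Fin n) ℂ, N X = 0 → X = 0
  unitary_invariant : ∀ U ∈ Matrix.unitaryGroup (Fin n) ℂ, ∀ V ∈ Matrix.unitaryGroup (Fin n) ℂ,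
    ∀ X : Matrix (Fin n) (Fin n) ℂ, N (U * X * V) = N X

/-- `absPow X s` is `|X| ^ s`, where `|X| = (Xᴴ * X) ^ (1 / 2)` and the real power of the positive
semidefinite matrix `|X|` is taken by the functional calculus. -/
noncomputable def absPow {n : ℕ} (X : Matrix (Fin n) (Fin n) ℂ) (s : ℝ) :
    Matrix (Fin n) (Fin n) ℂ :=
  CFC.rpow (CFC.abs X) s

/-! By the singular value decomposition and unitary invariance, `N (absPow X r)` depends only on the
`r`-th powers of the singular values of `X`. Horn's inequality bounds the products of the top
singular values of `B * C` by those of the entrywise product of the singular values of `B` and `C`.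
Taking logarithms, and using convexity of `exp`, turns this into weak majorization of `α`-th powers;
Young's inequality then acts entry by entry, and Ky Fan dominance carries the estimate to `N`.
Rescaling the two factors in Young's inequality by `t` and `t⁻¹` gives a family of bounds: `t = 1`
is the additive form, and optimizing over `t` gives the multiplicative one. Equality comes from
dividing the singular values of `A` as `s = s ^ (1 / p) * s ^ (1 / q)`. -/

/-! ### Functional calculus and singular value decomposition -/

open Matrix Polynomial in
theorem cfc_conj_diagonal {n : ℕ} {V : Matrix (Fin n) (Fin n) ℂ}
    (hV : V ∈ unitaryGroup (Fin n) ℂ) (d : Fin n → ℝ) (f : ℝ → ℝ) :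
    cfc f (star V * diagonal (fun i => (d i : ℂ)) * V) =
      star V * diagonal (fun i => (f (d i) : ℂ)) * V := by
  have hVs : V * star V = 1 := mem_unitaryGroup_iff.1 hV
  set φ : (Fin n → ℂ) →ₐ[ℝ] Matrix (Fin n) (Fin n) ℂ :=
    ((Unitary.conjStarAlgAut ℝ (Matrix (Fin n) (Fin n) ℂ)
      ⟨star V, Unitary.star_mem hV⟩).toAlgEquiv : _ →ₐ[ℝ] _).comp (diagonalAlgHom ℝ) with hφ
  have hφa (x : Fin n → ℂ) : φ x = star V * diagonal x * V := by
    simp [hφ, Unitary.conjStarAlgAut_apply]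
  -- The spectrum is finite, so `f` may be replaced by an interpolating polynomial, which commutes
  -- with the algebra homomorphism `φ`; no continuity of `f` is needed.
  set P : ℝ[X] := Lagrange.interpolate (Finset.univ.image d) id f with hP
  have hPd (i : Fin n) : P.eval (d i) = f (d i) := by
    simpa using! Lagrange.eval_interpolate_at_node (s := Finset.univ.image d) (v := id) f
      (fun _ _ _ _ h => h) (Finset.mem_image_of_mem d (Finset.mem_univ i))
  have hsa : IsSelfAdjoint (star V * diagonal (fun i => (d i : ℂ)) * V) := by
    have : IsSelfAdjoint (diagonal (fun i => (d i : ℂ))) := by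
      rw [IsSelfAdjoint, star_eq_conjTranspose, diagonal_conjTranspose]
      congr 1
      ext i
      simp
    exact this.conjugate' V
  have hspec : spectrum ℝ (star V * diagonal (fun i => (d i : ℂ)) * V) ⊆ Set.range d := by
    rw [← hφa]
    refine (AlgHom.spectrum_apply_subset φ _).trans ?_
    rw [Pi.spectrum_eq]
    refine Set.iUnion_subset fun i => ?_
    intro x hx
    refine ⟨i, ?_⟩
    have := spectrum.algebraMap_mem ℂ hx
    have h2 : algebraMap ℝ ℂ x ∈ spectrum ℂ (algebraMap ℂ ℂ (d i)) := this
    rw [spectrum.scalar_eq] at h2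
    exact Complex.ofReal_injective h2.symm
  have h1 : cfc f (star V * diagonal (fun i => (d i : ℂ)) * V) =
      cfc P.eval (star V * diagonal (fun i => (d i : ℂ)) * V) := by
    refine cfc_congr fun x hx => ?_
    obtain ⟨i, rfl⟩ := hspec hx
    exact (hPd i).symm
  rw [h1, cfc_polynomial P _ hsa, ← hφa, Polynomial.aeval_algHom_apply, hφa]
  congr
  ext i
  rw [← hPd i]
  have := Polynomial.aeval_algHom_apply (Pi.evalAlgHom ℝ (fun _ : Fin n => ℂ) i)
    (fun i => (d i : ℂ)) P
  simp only [Pi.evalAlgHom_apply] at this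
  rw [← this]
  exact Polynomial.aeval_algebraMap_apply ℂ (d i) P

open Matrix ComplexOrder in
theorem absPow_of_svd {n : ℕ} {U V : Matrix (Fin n) (Fin n) ℂ}
    (hU : U ∈ unitaryGroup (Fin n) ℂ) (hV : V ∈ unitaryGroup (Fin n) ℂ)
    {s : Fin n → ℝ} (hs : ∀ i, 0 ≤ s i) (r : ℝ) :
    absPow (U * diagonal (fun i => (s i : ℂ)) * V) r =
      star V * diagonal (fun i => ((s i ^ r : ℝ) : ℂ)) * V := by
  have hUs : star U * U = 1 := mem_unitaryGroup_iff'.1 hU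
  have hVs : V * star V = 1 := mem_unitaryGroup_iff.1 hV
  have hd : star (diagonal (fun i => (s i : ℂ))) = diagonal (fun i => (s i : ℂ)) := by
    rw [star_eq_conjTranspose, diagonal_conjTranspose]
    congr 1
    ext i
    simp
  have hpos : 0 ≤ star V * diagonal (fun i => (s i : ℂ)) * V := by
    rw [nonneg_iff_posSemidef, star_eq_conjTranspose]
    refine PosSemidef.conjTranspose_mul_mul_same (PosSemidef.diagonal fun i => ?_) V
    simpa using hs i
  have habs : CFC.abs (U * diagonal (fun i => (s i : ℂ)) * V) =
      star V * diagonal (fun i => (s i : ℂ)) * V := by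
    refine CFC.sqrt_unique ?_ hpos
    calc _ = star V * diagonal (fun i => (s i : ℂ)) * (V * star V) *
          diagonal (fun i => (s i : ℂ)) * V := by simp only [mul_assoc]
      _ = star V * diagonal (fun i => (s i : ℂ)) * (star U * U) *
          diagonal (fun i => (s i : ℂ)) * V := by rw [hVs, hUs]
      _ = _ := by rw [star_mul, star_mul, hd]; simp only [mul_assoc]
  rw [absPow, habs]
  change (star V * diagonal (fun i => (s i : ℂ)) * V) ^ r = _
  rw [CFC.rpow_eq_cfc_real hpos, cfc_conj_diagonal hV]

open Matrix ComplexOrder in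
theorem unitaryGroup_of_orthonormalBasis {n : ℕ}
    (b : OrthonormalBasis (Fin n) ℂ (EuclideanSpace ℂ (Fin n))) :
    (Matrix.of fun i j => b j i) ∈ unitaryGroup (Fin n) ℂ := by
  rw [mem_unitaryGroup_iff']
  ext i j
  have := orthonormal_iff_ite.1 b.orthonormal i j
  rw [Matrix.one_apply, ← this, Matrix.mul_apply, PiLp.inner_apply]
  refine Finset.sum_congr rfl fun k _ => ?_
  simp [mul_comm]

open Matrix ComplexOrder in
theorem exists_svd {n : ℕ} (X : Matrix (Fin n) (Fin n) ℂ) :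
    ∃ U ∈ unitaryGroup (Fin n) ℂ, ∃ V ∈ unitaryGroup (Fin n) ℂ, ∃ s : Fin n → ℝ,
      Antitone s ∧ (∀ i, 0 ≤ s i) ∧ X = U * diagonal (fun i => (s i : ℂ)) * V := by
  have hH : (Xᴴ * X).PosSemidef := posSemidef_conjTranspose_mul_self X
  set σ := Tuple.sort (fun i => -hH.1.eigenvalues i)
  have hσ : Antitone (hH.1.eigenvalues ∘ σ) := by
    have := Tuple.monotone_sort (fun i => -hH.1.eigenvalues i)
    intro i j hij
    simpa using this hij
  set d := hH.1.eigenvalues ∘ σ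
  have hd0 (i) : 0 ≤ d i := hH.eigenvalues_nonneg _
  set e := hH.1.eigenvectorBasis.reindex σ.symm
  have he (i) : (Xᴴ * X) *ᵥ (e i : Fin n → ℂ) = d i • (e i : Fin n → ℂ) := by
    simpa [e, d] using hH.1.mulVec_eigenvectorBasis (σ i)
  set y : Fin n → EuclideanSpace ℂ (Fin n) := fun i => WithLp.toLp 2 (X *ᵥ (e i : Fin n → ℂ))
  have hy (i j) : inner ℂ (y i) (y j) = if i = j then (d i : ℂ) else 0 := by
    have h1 : inner ℂ (y i) (y j) = inner ℂ (e i) (WithLp.toLp 2 ((Xᴴ * X) *ᵥ (e j : Fin n → ℂ))) := by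
      simp only [y, EuclideanSpace.inner_eq_star_dotProduct, ← mulVec_mulVec]
      rw [star_mulVec, dotProduct_comm, ← dotProduct_mulVec, dotProduct_comm]
    rw [h1, he, WithLp.toLp_smul, inner_smul_right_eq_smul]
    have := orthonormal_iff_ite.1 e.orthonormal i j
    change d j • inner ℂ (e i) (e j) = _
    rw [this]
    split_ifs with h
    · simp [h]
    · simp
  have hs (i) : ((√(d i) : ℝ) : ℂ) * (√(d i) : ℝ) = d i := by
    rw [← Complex.ofReal_mul, Real.mul_self_sqrt (hd0 i)]
  -- Only images with nonzero eigenvalue can be normalized; the remaining `y i` vanish, so any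
  -- orthonormal completion serves.
  have hon : Orthonormal ℂ (Set.domRestrict {i | d i ≠ 0} fun i => ((√(d i) : ℝ) : ℂ)⁻¹ • y i) := by
    rw [orthonormal_iff_ite]
    rintro ⟨i, hi⟩ ⟨j, hj⟩
    simp only [Set.domRestrict_apply, inner_smul_left, inner_smul_right, hy, Subtype.mk.injEq]
    have hi' : (d i : ℂ) ≠ 0 := by simpa using hi
    split_ifs with h
    · subst h
      rw [map_inv₀, Complex.conj_ofReal, ← mul_assoc, ← mul_inv, hs, inv_mul_cancel₀ hi']
    · simp
  obtain ⟨b, hb⟩ := hon.exists_orthonormalBasis_extension_of_card_eq (by simp)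
  have hyb (i) : y i = ((√(d i) : ℝ) : ℂ) • b i := by
    by_cases hi : d i = 0
    · have : inner ℂ (y i) (y i) = 0 := by rw [hy, if_pos rfl, hi]; simp
      rw [inner_self_eq_zero.1 this, hi]
      simp
    · rw [hb i hi, smul_inv_smul₀]
      simpa using (Real.sqrt_pos.2 (lt_of_le_of_ne (hd0 i) (Ne.symm hi))).ne'
  have hE := unitaryGroup_of_orthonormalBasis e
  refine ⟨_, unitaryGroup_of_orthonormalBasis b, _, Unitary.star_mem hE, fun i => √(d i),
    fun i j hij => Real.sqrt_le_sqrt (hσ hij), fun i => Real.sqrt_nonneg _, ?_⟩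
  have hXE : X * (Matrix.of fun i j => e j i) =
      (Matrix.of fun i j => b j i) * diagonal (fun i => ((√(d i) : ℝ) : ℂ)) := by
    ext i j
    rw [mul_diagonal]
    have := congrArg (fun v : EuclideanSpace ℂ (Fin n) => v i) (hyb j)
    simpa [y, mul_comm, Matrix.mul_apply, mulVec, dotProduct] using this
  rw [← hXE, mul_assoc, mem_unitaryGroup_iff.1 hE, mul_one]

/-! ### Cauchy–Binet and Horn's inequality -/

-- Cauchy–Binet, summed over all maps `f` instead of `k`-subsets: each subset occurs `k!` times, and
-- non-injective maps give zero minors.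
open Matrix in
theorem factorial_mul_det_conjTranspose_mul_diagonal_mul {n k : ℕ} (W : Matrix (Fin n) (Fin k) ℂ)
    (d : Fin n → ℂ) :
    (k.factorial : ℂ) * (Wᴴ * diagonal d * W).det =
      ∑ f : Fin k → Fin n, (∏ i, d (f i)) * (Complex.normSq (W.submatrix f id).det : ℂ) := by
  have h1 : (Wᴴ * diagonal d * W).det =
      ∑ f : Fin k → Fin n, (∏ i, star (W (f i) i) * d (f i)) * (W.submatrix f id).det := by
    have : Wᴴ * diagonal d * W = fun i => ∑ j, (star (W j i) * d j) • W j := by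
      ext i l
      simp [Matrix.mul_apply, diagonal, Finset.sum_apply]
    change detRowAlternating (Wᴴ * diagonal d * W) = _
    rw [this]
    change (detRowAlternating (R := ℂ) (n := Fin k)).toMultilinearMap _ = _
    rw [MultilinearMap.map_sum]
    refine Finset.sum_congr rfl fun f _ => ?_
    rw [MultilinearMap.map_smul_univ]
    rfl
  -- Reindexing `f` by `σ` extracts a sign from the minor; summing over `σ` assembles the conjugate
  -- minor.
  have h2 (σ : Equiv.Perm (Fin k)) : (Wᴴ * diagonal d * W).det =
      ∑ f : Fin k → Fin n, (∏ i, d (f i)) *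
        ((Equiv.Perm.sign σ : ℤ) * ∏ i, star (W (f (σ i)) i)) * (W.submatrix f id).det := by
    rw [h1, ← (Equiv.arrowCongr σ (Equiv.refl (Fin n))).symm.sum_comp]
    refine Finset.sum_congr rfl fun f _ => ?_
    have h3 : W.submatrix ((Equiv.arrowCongr σ (Equiv.refl (Fin n))).symm f) id =
        (W.submatrix f id).submatrix σ id := by
      ext i j; simp
    rw [h3, det_permute, Finset.prod_mul_distrib]
    have h4 : ∏ i, d ((Equiv.arrowCongr σ (Equiv.refl (Fin n))).symm f i) = ∏ i, d (f i) := by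
      simpa using Equiv.prod_comp σ (fun i => d (f i))
    rw [h4]
    simp
    ring
  have h5 : (k.factorial : ℂ) * (Wᴴ * diagonal d * W).det =
      ∑ _σ : Equiv.Perm (Fin k), (Wᴴ * diagonal d * W).det := by
    simp [Fintype.card_perm]
  rw [h5, Finset.sum_congr rfl fun σ _ => h2 σ, Finset.sum_comm]
  refine Finset.sum_congr rfl fun f _ => ?_
  rw [← Finset.sum_mul, ← Finset.mul_sum, mul_assoc, Complex.normSq_eq_conj_mul_self]
  congr 2
  rw [det_apply', map_sum]
  refine Finset.sum_congr rfl fun σ _ => ?_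
  simp

theorem Antitone.prod_comp_le_prod_castLE {n k : ℕ} (hk : k ≤ n) {d : Fin n → ℝ}
    (hd : Antitone d) (h0 : ∀ i, 0 ≤ d i) {f : Fin k → Fin n} (hf : Function.Injective f) :
    ∏ i, d (f i) ≤ ∏ i, d (Fin.castLE hk i) := by
  have hc : (Finset.univ.image f).card = k := by
    rw [Finset.card_image_of_injective _ hf]; simp
  set g := (Finset.univ.image f).orderEmbOfFin hc
  have h1 : ∏ i, d (f i) = ∏ i, d (g i) := by
    rw [← Finset.prod_image (s := Finset.univ) (g := f) (f := d) (fun _ _ _ _ h => hf h),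
      ← Finset.prod_image (s := Finset.univ) (g := g) (f := d) (fun _ _ _ _ h => g.injective h)]
    congr 1
    rw [Finset.image_orderEmbOfFin_univ]
  rw [h1]
  refine Finset.prod_le_prod (fun i _ => h0 _) fun i _ => hd ?_
  have hg : StrictMono (fun i => (g i : ℕ)) := fun i j h => g.strictMono h
  rw [Fin.le_def, Fin.val_castLE]
  -- The `m`-th smallest element of the image, counted from 0, is at least `m`.
  have key : ∀ m (hm : m < k), m ≤ (g ⟨m, hm⟩ : ℕ) := by
    intro m
    induction m with
    | zero => intro _; exact Nat.zero_le _
    | succ m ih =>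
      intro hm
      have := hg (show (⟨m, by omega⟩ : Fin k) < ⟨m + 1, hm⟩ from Nat.lt_succ_self m)
      have := ih (by omega)
      simp only at *
      omega
  exact key i i.2

open Matrix in
theorem det_re_conjTranspose_mul_diagonal_mul_le {n k : ℕ} (hk : k ≤ n)
    (W : Matrix (Fin n) (Fin k) ℂ) {d : Fin n → ℝ} (hd : Antitone d) (h0 : ∀ i, 0 ≤ d i) :
    (Wᴴ * diagonal (fun i => (d i : ℂ)) * W).det.re ≤
      (∏ i, d (Fin.castLE hk i)) * (Wᴴ * W).det.re := by
  have h (d : Fin n → ℝ) : (k.factorial : ℝ) * (Wᴴ * diagonal (fun i => (d i : ℂ)) * W).det.re =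
      ∑ f : Fin k → Fin n, (∏ i, d (f i)) * Complex.normSq (W.submatrix f id).det := by
    have := congrArg Complex.re (factorial_mul_det_conjTranspose_mul_diagonal_mul W
      (fun i => (d i : ℂ)))
    rw [← Complex.ofReal_natCast, Complex.re_ofReal_mul] at this
    rw [this, ← Complex.ofReal_re (∑ f : Fin k → Fin n, _)]
    push_cast
    rfl
  have h1 := h (fun _ => 1)
  simp only [Complex.ofReal_one, diagonal_one, Matrix.mul_one, Finset.prod_const_one, one_mul] at h1
  refine le_of_mul_le_mul_left ?_ (Nat.cast_pos.2 k.factorial_pos : (0 : ℝ) < k.factorial)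
  rw [h, mul_left_comm, h1, Finset.mul_sum]
  refine Finset.sum_le_sum fun f _ => ?_
  by_cases hf : Function.Injective f
  · exact mul_le_mul_of_nonneg_right (hd.prod_comp_le_prod_castLE hk h0 hf) (Complex.normSq_nonneg _)
  · obtain ⟨i, j, hij, hne⟩ := Function.not_injective_iff.1 hf
    have : (W.submatrix f id).det = 0 := det_zero_of_row_eq hne (by ext l; simp [hij])
    simp [this]

open Matrix in
/-- **Horn's inequality** for the products of the largest singular values of a product. -/
theorem prod_singularValues_mul_le {n k : ℕ} (hk : k ≤ n)
    {U₁ V₁ U₂ V₂ U V : Matrix (Fin n) (Fin n) ℂ} {s₁ s₂ s : Fin n → ℝ}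
    (hU₁ : U₁ ∈ unitaryGroup (Fin n) ℂ) (hV₁ : V₁ ∈ unitaryGroup (Fin n) ℂ)
    (hU₂ : U₂ ∈ unitaryGroup (Fin n) ℂ) (hV₂ : V₂ ∈ unitaryGroup (Fin n) ℂ)
    (hU : U ∈ unitaryGroup (Fin n) ℂ) (hV : V ∈ unitaryGroup (Fin n) ℂ)
    (h₁ : Antitone s₁) (h₁0 : ∀ i, 0 ≤ s₁ i) (h₂ : Antitone s₂) (h₂0 : ∀ i, 0 ≤ s₂ i)
    (h : U * diagonal (fun i => (s i : ℂ)) * V =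
      (U₁ * diagonal (fun i => (s₁ i : ℂ)) * V₁) * (U₂ * diagonal (fun i => (s₂ i : ℂ)) * V₂)) :
    ∏ i, s (Fin.castLE hk i) ≤ (∏ i, s₁ (Fin.castLE hk i)) * ∏ i, s₂ (Fin.castLE hk i) := by
  have gram {U V : Matrix (Fin n) (Fin n) ℂ} (s : Fin n → ℝ) (W : Matrix (Fin n) (Fin k) ℂ)
      (hU : U ∈ unitaryGroup (Fin n) ℂ) :
      (U * diagonal (fun i => (s i : ℂ)) * V * W)ᴴ * (U * diagonal (fun i => (s i : ℂ)) * V * W) =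
        (V * W)ᴴ * diagonal (fun i => ((s i ^ 2 : ℝ) : ℂ)) * (V * W) := by
    have hU' : Uᴴ * U = 1 := mem_unitaryGroup_iff'.1 hU
    have hd : (diagonal (fun i => (s i : ℂ)))ᴴ * diagonal (fun i => (s i : ℂ)) =
        diagonal (fun i => ((s i ^ 2 : ℝ) : ℂ)) := by
      rw [diagonal_conjTranspose, diagonal_mul_diagonal]
      congr 1
      ext i
      simp [sq]
    rw [← hd]
    calc _ = (V * W)ᴴ * (diagonal (fun i => (s i : ℂ)))ᴴ * (Uᴴ * U) *
          diagonal (fun i => (s i : ℂ)) * (V * W) := by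
            simp only [conjTranspose_mul, Matrix.mul_assoc]
      _ = _ := by rw [hU', Matrix.mul_one]; simp only [Matrix.mul_assoc]
  have isom {V : Matrix (Fin n) (Fin n) ℂ} (W : Matrix (Fin n) (Fin k) ℂ)
      (hV : V ∈ unitaryGroup (Fin n) ℂ) : (V * W)ᴴ * (V * W) = Wᴴ * W := by
    have hV' : Vᴴ * V = 1 := mem_unitaryGroup_iff'.1 hV
    rw [conjTranspose_mul, Matrix.mul_assoc, ← Matrix.mul_assoc Vᴴ, hV', Matrix.one_mul]
  have step {U V : Matrix (Fin n) (Fin n) ℂ} {s : Fin n → ℝ} (W : Matrix (Fin n) (Fin k) ℂ)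
      (hU : U ∈ unitaryGroup (Fin n) ℂ) (hV : V ∈ unitaryGroup (Fin n) ℂ)
      (hs : Antitone s) (hs0 : ∀ i, 0 ≤ s i) :
      ((U * diagonal (fun i => (s i : ℂ)) * V * W)ᴴ *
        (U * diagonal (fun i => (s i : ℂ)) * V * W)).det.re ≤
      (∏ i, s (Fin.castLE hk i)) ^ 2 * (Wᴴ * W).det.re := by
    rw [gram s W hU, ← isom W hV, ← Finset.prod_pow]
    exact det_re_conjTranspose_mul_diagonal_mul_le hk (V * W)
      (d := fun i => s i ^ 2) (fun i j hij => pow_le_pow_left₀ (hs0 j) (hs hij) 2)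
      (fun i => sq_nonneg _)
  -- `J` consists of the first `k` standard basis columns. Testing on `star V * J` makes the Gram
  -- determinant of the product exactly the square of the left-hand side.
  set J : Matrix (Fin n) (Fin k) ℂ := (1 : Matrix (Fin n) (Fin n) ℂ).submatrix id (Fin.castLE hk)
  have hJ (d : Fin n → ℂ) : Jᴴ * diagonal d * J = diagonal (fun i => d (Fin.castLE hk i)) := by
    have : Jᴴ * diagonal d * J = ((1 : Matrix (Fin n) (Fin n) ℂ) * diagonal d * 1).submatrix
        (Fin.castLE hk) (Fin.castLE hk) := by
      simp only [J, conjTranspose_submatrix, conjTranspose_one]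
      rw [submatrix_mul _ _ _ id _ Function.bijective_id,
        submatrix_mul _ _ _ id _ Function.bijective_id]
      simp
    rw [this, Matrix.one_mul, Matrix.mul_one, submatrix_diagonal _ _ (Fin.castLE_injective hk)]
    rfl
  have hJ1 : Jᴴ * J = 1 := by simpa using hJ (fun _ => 1)
  have hVs : V * star V = 1 := mem_unitaryGroup_iff.1 hV
  have hl := gram (V := V) s (star V * J) hU
  rw [← Matrix.mul_assoc V, hVs, Matrix.one_mul, hJ, h] at hl
  have hl' := congrArg (fun M => (det M).re) hl
  simp only [det_diagonal] at hl'
  rw [← Complex.ofReal_prod, Complex.ofReal_re, Finset.prod_pow, Matrix.mul_assoc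
    (U₁ * diagonal (fun i => (s₁ i : ℂ)) * V₁)] at hl'
  have e1 := step (U₂ * diagonal (fun i => (s₂ i : ℂ)) * V₂ * (star V * J)) hU₁ hV₁ h₁ h₁0
  have e2 := step (star V * J) hU₂ hV₂ h₂ h₂0
  rw [isom J (Unitary.star_mem hV), hJ1, det_one, Complex.one_re, mul_one] at e2
  rw [hl'] at e1
  refine le_of_sq_le_sq ?_ (mul_nonneg (Finset.prod_nonneg fun i _ => h₁0 _)
    (Finset.prod_nonneg fun i _ => h₂0 _))
  rw [mul_pow]
  exact e1.trans (mul_le_mul_of_nonneg_left e2 (sq_nonneg _))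

/-! ### From products to weighted sums of powers -/

/-- Abel summation, done inductively by subtracting the last weight from all the others. -/
theorem sum_mul_nonneg_of_antitone {n : ℕ} {w u : Fin n → ℝ} (hw : Antitone w)
    (hw0 : ∀ i, 0 ≤ w i) (hu : ∀ k (hk : k ≤ n), 0 ≤ ∑ i, u (Fin.castLE hk i)) :
    0 ≤ ∑ i, w i * u i := by
  induction n with
  | zero => simp
  | succ n ih =>
    have h1 := ih (w := fun i => w i.castSucc - w (Fin.last n)) (u := fun i => u i.castSucc)
      (fun i j hij => sub_le_sub_right (hw (Fin.castSucc_le_castSucc_iff.2 hij)) _)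
      (fun i => sub_nonneg.2 (hw (Fin.le_last _))) (fun k hk => hu k (hk.trans n.le_succ))
    have h2 := mul_nonneg (hw0 (Fin.last n)) (hu (n + 1) le_rfl)
    simp only [Fin.castLE_rfl, id, Fin.sum_univ_castSucc, mul_add, Finset.mul_sum] at h2
    rw [Fin.sum_univ_castSucc]
    simp only [sub_mul, Finset.sum_sub_distrib] at h1
    linarith

/-- The tangent line of `exp` gives `t ^ α - s ^ α ≥ α * s ^ α * (log t - log s)`. The weights `w *
α * s ^ α` are still antitone, so Abel summation applies to the logarithms. -/
theorem sum_mul_rpow_le_of_prod_le {n : ℕ} {w s t : Fin n → ℝ} (hw : Antitone w)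
    (hw0 : ∀ i, 0 ≤ w i) (hs : Antitone s) (hs0 : ∀ i, 0 ≤ s i) (ht0 : ∀ i, 0 ≤ t i)
    (h : ∀ k (hk : k ≤ n), ∏ i, s (Fin.castLE hk i) ≤ ∏ i, t (Fin.castLE hk i))
    {α : ℝ} (hα : 0 < α) :
    ∑ i, w i * s i ^ α ≤ ∑ i, w i * t i ^ α := by
  induction n with
  | zero => simp
  | succ n ih =>
    -- Logarithms need positivity: a zero last entry is dropped by induction; otherwise all `s i`
    -- are positive, and the full product forces the same for `t`.
    rcases (hs0 (Fin.last n)).eq_or_lt with h0 | h0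
    · rw [Fin.sum_univ_castSucc, Fin.sum_univ_castSucc, ← h0, Real.zero_rpow hα.ne', mul_zero]
      refine add_le_add (ih (w := fun i => w i.castSucc) (s := fun i => s i.castSucc)
        (t := fun i => t i.castSucc)
        (fun i j hij => hw (Fin.castSucc_le_castSucc_iff.2 hij)) (fun i => hw0 _)
        (fun i j hij => hs (Fin.castSucc_le_castSucc_iff.2 hij)) (fun i => hs0 _) (fun i => ht0 _)
        (fun k hk => h k (hk.trans n.le_succ)))
        (mul_nonneg (hw0 _) (Real.rpow_nonneg (ht0 _) _))
    · have hsp (i) : 0 < s i := h0.trans_le (hs (Fin.le_last i))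
      have htp (i) : 0 < t i := by
        have h1 : 0 < ∏ i, t i :=
          (Finset.prod_pos fun i _ => hsp i).trans_le (by simpa using h (n + 1) le_rfl)
        exact (ht0 i).lt_of_ne' (Finset.prod_ne_zero_iff.1 h1.ne' i (Finset.mem_univ i))
      have h1 : 0 ≤ ∑ i, (w i * (α * s i ^ α)) * (Real.log (t i) - Real.log (s i)) := by
        refine sum_mul_nonneg_of_antitone ?_ ?_ fun k hk => ?_
        · intro i j hij
          have := Real.rpow_le_rpow (hs0 j) (hs hij) hα.le
          exact mul_le_mul (hw hij) (mul_le_mul_of_nonneg_left this hα.le)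
            (mul_nonneg hα.le (Real.rpow_nonneg (hs0 _) _)) (hw0 _)
        · exact fun i => mul_nonneg (hw0 _) (mul_nonneg hα.le (Real.rpow_nonneg (hs0 _) _))
        · rw [Finset.sum_sub_distrib, ← Real.log_prod fun i _ => (htp _).ne',
            ← Real.log_prod fun i _ => (hsp _).ne', sub_nonneg]
          exact Real.log_le_log (Finset.prod_pos fun i _ => hsp _) (h k hk)
      rw [← sub_nonneg, ← Finset.sum_sub_distrib]
      refine h1.trans (Finset.sum_le_sum fun i _ => ?_)
      rw [← mul_sub, mul_assoc]
      refine mul_le_mul_of_nonneg_left ?_ (hw0 i)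
      have h2 : t i ^ α = s i ^ α * Real.exp (α * (Real.log (t i) - Real.log (s i))) := by
        rw [Real.rpow_def_of_pos (htp i), Real.rpow_def_of_pos (hsp i), ← Real.exp_add]
        ring_nf
      have h3 := mul_le_mul_of_nonneg_left
        (Real.add_one_le_exp (α * (Real.log (t i) - Real.log (s i))))
        (Real.rpow_nonneg (hs0 i) α)
      rw [h2]
      linarith

/-! ### Ky Fan dominance -/

open Matrix in
theorem Equiv.Perm.permMatrix_mem_unitaryGroup {n : ℕ} (σ : Equiv.Perm (Fin n)) :
    σ.permMatrix ℂ ∈ unitaryGroup (Fin n) ℂ := by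
  rw [mem_unitaryGroup_iff, star_eq_conjTranspose, conjTranspose_permMatrix, ← permMatrix_mul]
  simp

open Matrix in
theorem IsUnitarilyInvariantNorm.map_diagonal_signed_perm {n : ℕ}
    {N : Seminorm ℂ (Matrix (Fin n) (Fin n) ℂ)} (hN : IsUnitarilyInvariantNorm N)
    (ε y : Fin n → ℂ) (hε : ∀ i, ‖ε i‖ = 1) (σ : Equiv.Perm (Fin n)) :
    N (diagonal fun i => ε i * y (σ i)) = N (diagonal y) := by
  have hd : diagonal ε ∈ unitaryGroup (Fin n) ℂ := by
    rw [mem_unitaryGroup_iff, star_eq_conjTranspose, diagonal_conjTranspose,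
      diagonal_mul_diagonal, ← diagonal_one]
    congr 1
    ext i
    simp [Complex.mul_conj, Complex.normSq_eq_norm_sq, hε]
  have h : (diagonal fun i => ε i * y (σ i)) =
      (diagonal ε * σ.permMatrix ℂ) * diagonal y * σ⁻¹.permMatrix ℂ := by
    ext i j
    have hσ : σ.symm (σ⁻¹.symm j) = j := σ.symm_apply_apply j
    have hσ' : σ⁻¹.symm j = σ j := rfl
    simp only [PEquiv.mul_toMatrix_toPEquiv, submatrix_apply, mul_diagonal, diagonal_apply, hσ, id]
    split_ifs with hij
    · rw [hσ', hij]
    · rw [zero_mul]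
  rw [h, hN.unitary_invariant _ (mul_mem hd σ.permMatrix_mem_unitaryGroup) _
    σ⁻¹.permMatrix_mem_unitaryGroup]

open Matrix in
/-- **Ky Fan dominance** for diagonal matrices. -/
theorem IsUnitarilyInvariantNorm.map_diagonal_le {n : ℕ}
    {N : Seminorm ℂ (Matrix (Fin n) (Fin n) ℂ)} (hN : IsUnitarilyInvariantNorm N)
    {x y : Fin n → ℝ} (hx : Antitone x) (hx0 : ∀ i, 0 ≤ x i)
    (h : ∀ w : Fin n → ℝ, Antitone w → (∀ i, 0 ≤ w i) → ∑ i, w i * x i ≤ ∑ i, w i * y i) :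
    N (diagonal fun i => (x i : ℂ)) ≤ N (diagonal fun i => (y i : ℂ)) := by
  -- Hahn–Banach: a real functional dominated by `N` that attains it at `diagonal x`. Its diagonal
  -- coefficients, in absolute value and sorted, serve as the weights `w`; the signs and permutation
  -- then moved onto `y` do not change `N`.
  obtain ⟨g, hg, hgN⟩ : ∃ g : Matrix (Fin n) (Fin n) ℂ →ₗ[ℝ] ℝ,
      g (diagonal fun i => (x i : ℂ)) = N (diagonal fun i => (x i : ℂ)) ∧ ∀ X, g X ≤ N X := by
    set X := diagonal fun i => (x i : ℂ)
    have hNr (c : ℝ) (Y : Matrix (Fin n) (Fin n) ℂ) : N (c • Y) = |c| * N Y := by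
      have := map_smul_eq_mul N (c : ℂ) Y
      simpa using this
    by_cases hX : X = 0
    · exact ⟨0, by simp [hX], fun X => by simp⟩
    obtain ⟨g, hg1, hg2⟩ := exists_extension_of_le_sublinear
      (LinearPMap.mkSpanSingleton (K := ℝ) X (N X) hX) N
      (fun c hc Y => by rw [hNr, abs_of_pos hc]) (fun Y Z => map_add_le_add N Y Z) (by
        rintro ⟨Y, hY⟩
        obtain ⟨c, rfl⟩ := Submodule.mem_span_singleton.1 hY
        rw [LinearPMap.mkSpanSingleton'_apply, hNr, smul_eq_mul]
        exact mul_le_mul_of_nonneg_right (le_abs_self c) (apply_nonneg N X))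
    refine ⟨g, ?_, hg2⟩
    exact (hg1 ⟨X, Submodule.mem_span_singleton_self X⟩).trans
      (LinearPMap.mkSpanSingleton_apply ℝ ℝ hX (N X))
  set c : Fin n → ℝ := fun i => g (single i i 1)
  have hgd (z : Fin n → ℝ) : g (diagonal fun i => (z i : ℂ)) = ∑ i, c i * z i := by
    have : (diagonal fun i => (z i : ℂ)) = ∑ i, z i • single i i (1 : ℂ) := by
      rw [← sum_single_eq_diagonal]
      simp
    rw [this, map_sum]
    exact Finset.sum_congr rfl fun i _ => by rw [map_smul, smul_eq_mul, mul_comm]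
  set σ := Tuple.sort fun i => -|c i|
  have hσ : Antitone fun i => |c (σ i)| := by
    have := Tuple.monotone_sort fun i => -|c i|
    intro i j hij
    simpa using this hij
  have hsign (i) : c i * (if 0 ≤ c i then 1 else -1) = |c i| := by
    split_ifs with hc
    · rw [abs_of_nonneg hc, mul_one]
    · rw [abs_of_neg (not_le.1 hc)]; ring
  calc N (diagonal fun i => (x i : ℂ)) = ∑ i, c i * x i := by rw [← hg, hgd]
    _ ≤ ∑ i, |c i| * x i :=
      Finset.sum_le_sum fun i _ => mul_le_mul_of_nonneg_right (le_abs_self _) (hx0 i)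
    _ ≤ ∑ i, |c (σ i)| * x i := by
      have := (hσ.monovary hx).sum_comp_perm_mul_le_sum_mul (σ := σ⁻¹)
      simpa using this
    _ ≤ ∑ i, |c (σ i)| * y i := h _ hσ fun i => abs_nonneg _
    _ = ∑ i, |c i| * y (σ⁻¹ i) := by
      rw [← Equiv.sum_comp σ fun i => |c i| * y (σ⁻¹ i)]
      simp
    _ = g (diagonal fun i => (((if 0 ≤ c i then 1 else -1) * y (σ⁻¹ i) : ℝ) : ℂ)) := by
      rw [hgd]
      refine Finset.sum_congr rfl fun i _ => ?_
      rw [← mul_assoc, hsign]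
    _ ≤ N (diagonal fun i => (((if 0 ≤ c i then 1 else -1) * y (σ⁻¹ i) : ℝ) : ℂ)) := hgN _
    _ = N (diagonal fun i => (y i : ℂ)) := by
      rw [← hN.map_diagonal_signed_perm (fun i => ((if 0 ≤ c i then 1 else -1 : ℝ) : ℂ))
        (fun i => (y i : ℂ))
        (fun i => by split_ifs <;> simp) σ⁻¹]
      simp only [Complex.ofReal_mul]

open Matrix in
theorem IsUnitarilyInvariantNorm.map_absPow {n : ℕ}
    {N : Seminorm ℂ (Matrix (Fin n) (Fin n) ℂ)} (hN : IsUnitarilyInvariantNorm N)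
    {U V : Matrix (Fin n) (Fin n) ℂ}
    (hU : U ∈ unitaryGroup (Fin n) ℂ) (hV : V ∈ unitaryGroup (Fin n) ℂ)
    {s : Fin n → ℝ} (hs : ∀ i, 0 ≤ s i) (r : ℝ) :
    N (absPow (U * diagonal (fun i => (s i : ℂ)) * V) r) =
      N (diagonal fun i => ((s i ^ r : ℝ) : ℂ)) := by
  rw [absPow_of_svd hU hV hs, hN.unitary_invariant _ (Unitary.star_mem hV) _ hV]

/-! ### Young's inequality, optimization and equality -/

open Matrix in
theorem IsUnitarilyInvariantNorm.map_absPow_mul_le_young {n : ℕ}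
    {N : Seminorm ℂ (Matrix (Fin n) (Fin n) ℂ)} (hN : IsUnitarilyInvariantNorm N)
    (B C : Matrix (Fin n) (Fin n) ℂ) {α p q t : ℝ} (hα : 0 < α) (hpq : p.HolderConjugate q)
    (ht : 0 < t) :
    N (absPow (B * C) α) ≤
      1 / p * (t ^ p * N (absPow B (α * p))) + 1 / q * ((t ^ q)⁻¹ * N (absPow C (α * q))) := by
  obtain ⟨U, hU, V, hV, s, hs, hs0, h⟩ := exists_svd (B * C)
  obtain ⟨U₁, hU₁, V₁, hV₁, s₁, hs₁, hs₁0, rfl⟩ := exists_svd B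
  obtain ⟨U₂, hU₂, V₂, hV₂, s₂, hs₂, hs₂0, rfl⟩ := exists_svd C
  have hα0 {x y : ℝ} (hx : 0 ≤ x) (hxy : x ≤ y) : x ^ α ≤ y ^ α := Real.rpow_le_rpow hx hxy hα.le
  rw [hN.map_absPow hU₁ hV₁ hs₁0, hN.map_absPow hU₂ hV₂ hs₂0, h, hN.map_absPow hU hV hs0]
  set y : Fin n → ℝ := fun i =>
    (1 / p * t ^ p) * s₁ i ^ (α * p) + (1 / q * (t ^ q)⁻¹) * s₂ i ^ (α * q)
  have hy : (diagonal fun i => (y i : ℂ)) =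
      ((1 / p * t ^ p : ℝ) : ℂ) • (diagonal fun i => ((s₁ i ^ (α * p) : ℝ) : ℂ)) +
      ((1 / q * (t ^ q)⁻¹ : ℝ) : ℂ) • (diagonal fun i => ((s₂ i ^ (α * q) : ℝ) : ℂ)) := by
    rw [← diagonal_smul, ← diagonal_smul, diagonal_add]
    congr 1
    ext i
    simp only [y, Pi.smul_apply, smul_eq_mul, Complex.ofReal_add, Complex.ofReal_mul]
  have hp0 : 0 ≤ 1 / p * t ^ p :=
    mul_nonneg (one_div_nonneg.2 hpq.nonneg) (Real.rpow_nonneg ht.le _)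
  have hq0 : 0 ≤ 1 / q * (t ^ q)⁻¹ :=
    mul_nonneg (one_div_nonneg.2 hpq.symm.nonneg) (inv_nonneg.2 (Real.rpow_nonneg ht.le _))
  refine (hN.map_diagonal_le (y := y) (fun i j hij => hα0 (hs0 _) (hs hij))
    (fun i => Real.rpow_nonneg (hs0 i) α) fun w hw hw0 => ?_).trans ?_
  · refine (sum_mul_rpow_le_of_prod_le (t := fun i => s₁ i * s₂ i) hw hw0 hs hs0
      (fun i => mul_nonneg (hs₁0 i) (hs₂0 i)) (fun k hk => ?_) hα).trans
      (Finset.sum_le_sum fun i _ => mul_le_mul_of_nonneg_left ?_ (hw0 i))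
    · rw [Finset.prod_mul_distrib]
      exact prod_singularValues_mul_le hk hU₁ hV₁ hU₂ hV₂ hU hV hs₁ hs₁0 hs₂ hs₂0 h.symm
    · have h₁ := Real.rpow_nonneg (hs₁0 i) α
      have h₂ := Real.rpow_nonneg (hs₂0 i) α
      have := Real.young_inequality_of_nonneg (mul_nonneg ht.le h₁)
        (mul_nonneg (inv_nonneg.2 ht.le) h₂) hpq
      rw [Real.mul_rpow ht.le h₁, Real.mul_rpow (inv_nonneg.2 ht.le) h₂, ← Real.rpow_mul (hs₁0 i),
        ← Real.rpow_mul (hs₂0 i), Real.inv_rpow ht.le] at this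
      rw [Real.mul_rpow (hs₁0 i) (hs₂0 i)]
      refine le_trans (le_of_eq ?_) (this.trans (le_of_eq ?_))
      · field_simp
      · simp only [y]; ring
  · rw [hy]
    refine (map_add_le_add N _ _).trans (le_of_eq ?_)
    rw [map_smul_eq_mul, map_smul_eq_mul, Complex.norm_of_nonneg hp0, Complex.norm_of_nonneg hq0,
      mul_assoc, mul_assoc]

theorem Real.le_rpow_mul_rpow_of_forall_young {p q x y z : ℝ} (hpq : p.HolderConjugate q)
    (hx : 0 ≤ x) (hy : 0 ≤ y)
    (h : ∀ t : ℝ, 0 < t → z ≤ 1 / p * (t ^ p * x) + 1 / q * ((t ^ q)⁻¹ * y)) :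
    z ≤ x ^ (1 / p) * y ^ (1 / q) := by
  have hp := hpq.pos
  have hq := hpq.symm.pos
  have hsum : 1 / p + 1 / q = 1 := by simpa using hpq.inv_add_inv_eq_one
  have hpos {a b : ℝ} (ha : 0 < a) (hb : 0 < b) (hxa : x ≤ a) (hyb : y ≤ b) :
      z ≤ a ^ (1 / p) * b ^ (1 / q) := by
    -- The minimizer, which equalizes `t ^ p * a` and `(t ^ q)⁻¹ * b`: `t ^ (p + q) = b / a`, where
    -- `p + q = p * q`.
    set t : ℝ := b ^ (1 / (p * q)) * a ^ (-(1 / (p * q)))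
    have hb' := Real.rpow_pos_of_pos hb (1 / (p * q))
    have ha' := Real.rpow_pos_of_pos ha (-(1 / (p * q)))
    have ht : 0 < t := mul_pos hb' ha'
    have h1 : t ^ p * a = a ^ (1 / p) * b ^ (1 / q) := by
      rw [Real.mul_rpow hb'.le ha'.le, ← Real.rpow_mul hb.le, ← Real.rpow_mul ha.le, mul_assoc]
      nth_rw 2 [← Real.rpow_one a]
      rw [← Real.rpow_add ha, mul_comm]
      congr 2
      · rw [show 1 / p = 1 - 1 / q by linarith]
        field_simp
        ring
      · field_simp
    have h2 : (t ^ q)⁻¹ * b = a ^ (1 / p) * b ^ (1 / q) := by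
      rw [Real.mul_rpow hb'.le ha'.le, ← Real.rpow_mul hb.le, ← Real.rpow_mul ha.le, mul_inv,
        ← Real.rpow_neg hb.le, ← Real.rpow_neg ha.le, mul_right_comm]
      nth_rw 2 [← Real.rpow_one b]
      rw [← Real.rpow_add hb, mul_comm]
      congr 2
      · field_simp
      · rw [show 1 / q = 1 - 1 / p by linarith]
        field_simp
        ring
    calc z ≤ 1 / p * (t ^ p * x) + 1 / q * ((t ^ q)⁻¹ * y) := h t ht
      _ ≤ 1 / p * (t ^ p * a) + 1 / q * ((t ^ q)⁻¹ * b) := by gcongr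
      _ = a ^ (1 / p) * b ^ (1 / q) := by rw [h1, h2, ← add_mul, hsum, one_mul]
  -- If `x` or `y` is zero there may be no optimal `t`, so both are shifted by `ε > 0` before
  -- passing to the limit.
  have hlim : Filter.Tendsto (fun ε : ℝ => (x + ε) ^ (1 / p) * (y + ε) ^ (1 / q))
      (nhdsWithin 0 (Set.Ioi 0)) (nhds (x ^ (1 / p) * y ^ (1 / q))) := by
    have hc : Continuous fun ε : ℝ => (x + ε) ^ (1 / p) * (y + ε) ^ (1 / q) :=
      ((continuous_const.add continuous_id).rpow_const fun _ => Or.inr (by positivity)).mul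
        ((continuous_const.add continuous_id).rpow_const fun _ => Or.inr (by positivity))
    simpa using (hc.tendsto 0).mono_left nhdsWithin_le_nhds
  refine ge_of_tendsto hlim (Filter.eventually_of_mem self_mem_nhdsWithin fun ε hε => ?_)
  have hε' : (0 : ℝ) < ε := hε
  exact hpos (by linarith) (by linarith) (by linarith) (by linarith)

open Matrix in
theorem exists_mul_eq_map_absPow_eq {n : ℕ}
    {N : Seminorm ℂ (Matrix (Fin n) (Fin n) ℂ)} (hN : IsUnitarilyInvariantNorm N)
    (A : Matrix (Fin n) (Fin n) ℂ) (α : ℝ) {p q : ℝ} (hpq : p.HolderConjugate q) :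
    ∃ B C : Matrix (Fin n) (Fin n) ℂ, A = B * C ∧ N (absPow B (α * p)) = N (absPow A α) ∧
      N (absPow C (α * q)) = N (absPow A α) := by
  obtain ⟨U, hU, V, hV, s, -, hs0, rfl⟩ := exists_svd A
  have hp := hpq.pos
  have hq := hpq.symm.pos
  have hsum : 1 / p + 1 / q = 1 := by simpa using hpq.inv_add_inv_eq_one
  refine ⟨U * diagonal (fun i => ((s i ^ (1 / p) : ℝ) : ℂ)) * 1,
    1 * diagonal (fun i => ((s i ^ (1 / q) : ℝ) : ℂ)) * V, ?_, ?_, ?_⟩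
  · have : (fun i => (s i : ℂ)) =
        fun i => ((s i ^ (1 / p) : ℝ) : ℂ) * ((s i ^ (1 / q) : ℝ) : ℂ) := by
      ext i
      rw [← Complex.ofReal_mul, ← Real.rpow_add_of_nonneg (hs0 i) (by positivity) (by positivity),
        hsum, Real.rpow_one]
    rw [this, ← diagonal_mul_diagonal]
    simp only [Matrix.mul_assoc, Matrix.mul_one, Matrix.one_mul]
  all_goals
    rw [hN.map_absPow hU hV hs0]
  · rw [hN.map_absPow hU (one_mem _) fun i => Real.rpow_nonneg (hs0 i) _]
    simp only [← Real.rpow_mul (hs0 _)]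
    rw [show 1 / p * (α * p) = α by field_simp]
  · rw [hN.map_absPow (one_mem _) hV fun i => Real.rpow_nonneg (hs0 i) _]
    simp only [← Real.rpow_mul (hs0 _)]
    rw [show 1 / q * (α * q) = α by field_simp]

theorem proposition1 {n : ℕ} (A : Matrix (Fin n) (Fin n) ℂ) (α p q : ℝ)
    (hα : 0 < α) (hp : 1 < p) (hq : q = p / (p - 1))
    (N : Seminorm ℂ (Matrix (Fin n) (Fin n) ℂ)) (hN : IsUnitarilyInvariantNorm N) :
    IsLeast {x : ℝ | ∃ B C : Matrix (Fin n) (Fin n) ℂ, A = B * C ∧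
        x = N (absPow B (α * p)) ^ (1 / p) * N (absPow C (α * q)) ^ (1 / q)}
      (N (absPow A α)) ∧
    IsLeast {x : ℝ | ∃ B C : Matrix (Fin n) (Fin n) ℂ, A = B * C ∧
        x = 1 / p * N (absPow B (α * p)) + 1 / q * N (absPow C (α * q))}
      (N (absPow A α)) := by
  have hpq : p.HolderConjugate q := (Real.holderConjugate_iff_eq_conjExponent hp).2 hq
  have hsum : 1 / p + 1 / q = 1 := by simpa using hpq.inv_add_inv_eq_one
  have hp0 := hpq.pos
  have hq0 := hpq.symm.pos
  obtain ⟨B, C, hA, hB, hC⟩ := exists_mul_eq_map_absPow_eq hN A α hpq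
  refine ⟨⟨⟨B, C, hA, ?_⟩, ?_⟩, ⟨B, C, hA, ?_⟩, ?_⟩
  · rw [hB, hC, ← Real.rpow_add_of_nonneg (apply_nonneg N _) (by positivity) (by positivity),
      hsum, Real.rpow_one]
  · rintro _ ⟨B, C, rfl, rfl⟩
    exact Real.le_rpow_mul_rpow_of_forall_young hpq (apply_nonneg N _) (apply_nonneg N _)
      fun t ht => hN.map_absPow_mul_le_young B C hα hpq ht
  · rw [hB, hC, ← add_mul, hsum, one_mul]
  · rintro _ ⟨B, C, rfl, rfl⟩
    simpa using hN.map_absPow_mul_le_young B C hα hpq one_pos
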